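/- Let $\mathcal X$ be a complete separable metric space with its Borel $\sigma$-field, and let $\mathcal F$ be a countable family of Borel measurable functions $f:\mathcal X\to\mathbb R$ with envelope $F$, i.e. $F:\mathcal X\to[0,\infty)$ is measurable and $|f(x)|\le F(x)$ for all $x\in\mathcal X$ and $f\in\mathcal F$. For a family $\mathcal C$ of subsets of $\mathcal X$, let $\dim(\mathcal C)\in\{0,1,2,\dots,\infty\}$ be its VC dimension, i.e. the supremum of the cardinalities $|D|$ of the finite sets $D\subseteq\mathcal X$ with $|\{C\cap D: C\in\mathcal C\}|=2^{|D|}$ (and $0$ if there are none). Suppose that $\mathcal F$ is a VC-major class, i.e. $$\sup_{\alpha\in\mathbb R}\dim\bigl(\bigl\{\{x\in\mathcal X: f(x)\le\alpha\}: f\in\mathcal F\bigr\}\bigr)<\infty .$$ Then for every stationary ergodic process $X_1,X_2,\dots$ with values in $\mathcal X$ such that $E F(X_1)<\infty$, the expectations $E f(X_1)$, $f\in\mathcal F$, are well defined and finite, and $$\sup_{f\in\mathcal F}\Bigl|\frac1m\sum_{i=1}^m f(X_i)-E f(X_1)\Bigr|\to 0\quad\text{with probability one as } m\to\infty .$$ Here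 a process is ergodic if its invariant $\sigma$-field is trivial, i.e. every shift-invariant measurable set of sequences has probability $0$ or $1$ under the law of the process. -/

import Mathlib

open MeasureTheory Filter
open scoped ENNReal Topology

/-- The shatter coefficient `S(D : 𝒞) = |{C ∩ D : C ∈ 𝒞}|`: the number of distinct subsets of the
finite set `D` that are captured by members of `𝒞`. -/
noncomputable def shatterCoeff {α : Type*} (D : Finset α) (𝒞 : Set (Set α)) : ℕ :=
  Set.ncard {E : Set α | ∃ C ∈ 𝒞, E = C ∩ (D : Set α)}

/-- The VC dimension of a family of sets, with values in `ℕ∞`: the supremum of the cardinalities of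
the finite sets `D` that are shattered by `𝒞`, i.e. such that `S(D : 𝒞) = 2 ^ |D|`
(it is `0` if no nonempty set is shattered). -/
noncomputable def vcDim {α : Type*} (𝒞 : Set (Set α)) : ℕ∞ :=
  ⨆ (D : Finset α) (_ : shatterCoeff D 𝒞 = 2 ^ D.card), (D.card : ℕ∞)

/-- The level set `L_f(a) = {x : f x ≤ a}`. -/
def levelSet {α : Type*} (f : α → ℝ) (a : ℝ) : Set α := {x | f x ≤ a}

/-- `sup_a dim {L_f(a) : f ∈ 𝓕}`, the supremum being over all real levels `a`. -/
noncomputable def vcMajorDim {α : Type*} (𝓕 : Set (α → ℝ)) : ℕ∞ :=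
  ⨆ a : ℝ, vcDim {L : Set α | ∃ f ∈ 𝓕, L = levelSet f a}

/-- A family of real functions is a VC-major class if `sup_a dim {L_f(a) : f ∈ 𝓕}` is finite. -/
def IsVCMajor {α : Type*} (𝓕 : Set (α → ℝ)) : Prop := vcMajorDim 𝓕 < ⊤

/-- `F` is an envelope of `𝓕`: a measurable function to `[0, ∞)` with `|f x| ≤ F x` for all
`f ∈ 𝓕` and all `x`. -/
structure IsEnvelope {α : Type*} [MeasurableSpace α] (F : α → ℝ) (𝓕 : Set (α → ℝ)) : Prop where
  measurable : Measurable F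
  nonneg : ∀ x, 0 ≤ F x
  abs_le : ∀ f ∈ 𝓕, ∀ x, |f x| ≤ F x

/-- The left shift on one-sided sequences. -/
def seqShift {α : Type*} (x : ℕ → α) : ℕ → α := fun n => x (n + 1)

/-- The law of the process `X` on the sequence space (with the product sigma-field). -/
noncomputable def processLaw {Ω α : Type*} [MeasurableSpace Ω] [MeasurableSpace α]
    (X : ℕ → Ω → α) (P : Measure Ω) : Measure (ℕ → α) :=
  P.map (fun ω n => X n ω)

/-- A stationary ergodic process: a sequence of random variables whose law on the sequence space is
preserved by the shift (stationarity) and gives every shift-invariant measurable set measure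
zero or full measure (triviality of the invariant sigma-field). -/
structure IsStationaryErgodic {Ω α : Type*} [MeasurableSpace Ω] [MeasurableSpace α]
    (X : ℕ → Ω → α) (P : Measure Ω) : Prop where
  measurable : ∀ n, Measurable (X n)
  stationary : MeasurePreserving seqShift (processLaw X P) (processLaw X P)
  ergodic : PreErgodic seqShift (processLaw X P)

/-- The random variable `sup_{f ∈ 𝓕} |m⁻¹ ∑ f(X_i) - E f(X)|`, with values in `[0, ∞]`. The first
`m` variables of the process are `X 0, …, X (m - 1)`, and `X` has the law of `X 0`. -/
noncomputable def uniformDeviation {Ω α : Type*} [MeasurableSpace Ω]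
    (𝓕 : Set (α → ℝ)) (X : ℕ → Ω → α) (P : Measure Ω) (m : ℕ) (ω : Ω) : ℝ≥0∞ :=
  ⨆ f ∈ 𝓕, ENNReal.ofReal |(m : ℝ)⁻¹ * (∑ i ∈ Finset.range m, f (X i ω)) - ∫ ω', f (X 0 ω') ∂P|

/-- `𝓕` is a Glivenko–Cantelli class for the process `X`: the expectations `E f(X)` exist, and the
averages converge to them uniformly over `𝓕` with probability one. -/
def IsGlivenkoCantelli {Ω α : Type*} [MeasurableSpace Ω]
    (𝓕 : Set (α → ℝ)) (X : ℕ → Ω → α) (P : Measure Ω) : Prop :=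
  (∀ f ∈ 𝓕, Integrable (fun ω => f (X 0 ω)) P) ∧
    ∀ᵐ ω ∂P, Tendsto (fun m : ℕ => uniformDeviation 𝓕 X P m ω) atTop (𝓝 0)

/-!
For each `ε > 0`, a family with finite `L¹` bracketing numbers is trapped between finitely many
pairs of functions, and Birkhoff's theorem for those functions makes the ergodic averages converge
uniformly over the family.

A family of sets of finite VC dimension has finite bracketing numbers. Indeed, follow the sets along
an ultrafilter: either they end up trapped between two sets of nearly equal measure, or there is a
nonnull set all of whose nonnull parts they eventually split. In the second case one chooses sets of
the family one at a time, each splitting all the atoms of its predecessors, so that the family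
contains Boolean independent subfamilies of every finite size and its VC dimension is infinite.

A real function is, up to a small error in `L¹`, a combination of indicators of its level sets, so
bracketing passes from the level sets to the functions.
-/

section BirkhoffMax

variable {α : Type*} {T : α → α} {f : α → ℝ}

/-- The running maximum `max (0, S₁ f, …, Sₙ f)` of the Birkhoff sums of `f` along `T`, the object
of the maximal ergodic inequality. -/
noncomputable def birkhoffMax (T : α → α) (f : α → ℝ) (n : ℕ) (x : α) : ℝ :=
  partialSups (fun k => birkhoffSum T f k x) n

lemma birkhoffMax_zero (x : α) : birkhoffMax T f 0 x = 0 := by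
  simp [birkhoffMax]

lemma birkhoffMax_nonneg (n : ℕ) (x : α) : 0 ≤ birkhoffMax T f n x := by
  simpa [birkhoffMax] using le_partialSups_of_le (fun k => birkhoffSum T f k x) (Nat.zero_le n)

lemma birkhoffMax_monotone (x : α) : Monotone fun n => birkhoffMax T f n x :=
  partialSups_monotone _

lemma birkhoffMax_succ (n : ℕ) (x : α) :
    birkhoffMax T f (n + 1) x = max 0 (f x + birkhoffMax T f n (T x)) := by
  refine le_antisymm (partialSups_le _ _ _ fun k hk => ?_) (max_le (birkhoffMax_nonneg _ _) ?_)
  · cases k with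
    | zero => simp
    | succ k =>
      rw [birkhoffSum_succ']
      exact le_max_of_le_right (add_le_add_right
        (le_partialSups_of_le (fun k => birkhoffSum T f k (T x)) (Nat.succ_le_succ_iff.1 hk)) _)
  · rw [← le_sub_iff_add_le']
    refine partialSups_le _ _ _ fun k hk => ?_
    rw [le_sub_iff_add_le', ← birkhoffSum_succ']
    exact le_partialSups_of_le (fun k => birkhoffSum T f k x) (Nat.succ_le_succ hk)

lemma birkhoffMax_succ_sub_comp (n : ℕ) (x : α) :
    birkhoffMax T f (n + 1) x - birkhoffMax T f n (T x) =
      max (-birkhoffMax T f n (T x)) (f x) := by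
  rw [birkhoffMax_succ, ← max_sub_sub_right, zero_sub, add_sub_cancel_right]

/-- The invariant set of points along whose orbits the Birkhoff sums are unbounded above, over
which the maximal ergodic inequality integrates. -/
def birkhoffUnbounded (T : α → α) (f : α → ℝ) : Set α :=
  {x | ¬ BddAbove (Set.range fun n => birkhoffSum T f n x)}

lemma preimage_birkhoffUnbounded : T ⁻¹' birkhoffUnbounded T f = birkhoffUnbounded T f := by
  ext x
  refine not_congr ⟨?_, ?_⟩ <;> rintro ⟨b, hb⟩ <;> rw [mem_upperBounds, Set.forall_mem_range] at hb
  · refine ⟨max 0 (f x + b), Set.forall_mem_range.2 fun n => ?_⟩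
    cases n with
    | zero => simp
    | succ n =>
      rw [birkhoffSum_succ']
      exact le_max_of_le_right (add_le_add_right (hb n) _)
  · refine ⟨b - f x, Set.forall_mem_range.2 fun n => ?_⟩
    rw [le_sub_iff_add_le', ← birkhoffSum_succ']
    exact hb (n + 1)

lemma tendsto_birkhoffMax_atTop {x : α} (hx : x ∈ birkhoffUnbounded T f) :
    Tendsto (fun n => birkhoffMax T f n x) atTop atTop :=
  tendsto_atTop_atTop_of_monotone' (birkhoffMax_monotone x) (mt bddAbove_range_partialSups.1 hx)

end BirkhoffMax

section Birkhoff

variable {α β : Type*} [MeasurableSpace α] [MeasurableSpace β] {μ : Measure α}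
  {T : α → α} {f : α → ℝ}

lemma integral_comp_of_measurePreserving {ν : Measure β} {π : β → α}
    (hπ : MeasurePreserving π ν μ) (hf : AEStronglyMeasurable f μ) :
    ∫ y, f (π y) ∂ν = ∫ x, f x ∂μ := by
  rw [← hπ.map_eq] at hf ⊢
  exact (integral_map hπ.aemeasurable hf).symm

lemma measurable_birkhoffSum (hT : Measurable T) (hf : Measurable f) (n : ℕ) :
    Measurable (birkhoffSum T f n) :=
  Finset.measurable_fun_sum _ fun k _ => hf.comp (hT.iterate k)

lemma measurableSet_birkhoffUnbounded (hT : Measurable T) (hf : Measurable f) :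
    MeasurableSet (birkhoffUnbounded T f) :=
  (measurableSet_bddAbove_range (measurable_birkhoffSum hT hf)).compl

lemma integrable_birkhoffMax (hT : MeasurePreserving T μ μ) (hf : Integrable f μ) (n : ℕ) :
    Integrable (birkhoffMax T f n) μ := by
  induction n with
  | zero =>
    rw [funext birkhoffMax_zero]
    exact integrable_zero _ _ _
  | succ n ih =>
    rw [funext (birkhoffMax_succ n)]
    exact (integrable_zero _ _ _).sup (hf.add (hT.integrable_comp_of_integrable ih))

theorem setIntegral_birkhoffUnbounded_nonneg (hT : MeasurePreserving T μ μ) (hf : Measurable f)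
    (hfi : Integrable f μ) : 0 ≤ ∫ x in birkhoffUnbounded T f, f x ∂μ := by
  set A := birkhoffUnbounded T f
  have hA : MeasurableSet A := measurableSet_birkhoffUnbounded hT.measurable hf
  have hTA : MeasurePreserving T (μ.restrict A) (μ.restrict A) := by
    simpa only [A, preimage_birkhoffUnbounded] using hT.restrict_preimage hA
  have hM n : Integrable (birkhoffMax T f n) (μ.restrict A) :=
    (integrable_birkhoffMax hT hfi n).restrict
  have hMT n : Integrable (fun x => birkhoffMax T f n (T x)) (μ.restrict A) :=
    hTA.integrable_comp_of_integrable (hM n)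
  have hlim : Tendsto (fun n => ∫ x in A, (birkhoffMax T f (n + 1) x - birkhoffMax T f n (T x)) ∂μ)
      atTop (𝓝 (∫ x in A, f x ∂μ)) := by
    refine tendsto_integral_of_dominated_convergence (fun x => |f x|)
      (fun n => ((hM (n + 1)).sub (hMT n)).aestronglyMeasurable) hfi.abs.restrict
      (fun n => ae_of_all _ fun x => ?_) ?_
    · rw [birkhoffMax_succ_sub_comp, Real.norm_eq_abs, abs_le]
      exact ⟨le_max_of_le_right (neg_abs_le _), max_le
        ((neg_nonpos.2 (birkhoffMax_nonneg _ _)).trans (abs_nonneg _)) (le_abs_self _)⟩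
    · filter_upwards [ae_restrict_mem hA] with x hx
      have hTx : T x ∈ birkhoffUnbounded T f := preimage_birkhoffUnbounded.ge hx
      refine tendsto_const_nhds.congr' ?_
      filter_upwards [(tendsto_birkhoffMax_atTop hTx).eventually_ge_atTop (-f x)] with n hn
      rw [birkhoffMax_succ_sub_comp, max_eq_right (neg_le.1 hn)]
  refine ge_of_tendsto' hlim fun n => ?_
  rw [integral_sub (hM _) (hMT n),
    integral_comp_of_measurePreserving hTA (hM n).aestronglyMeasurable, sub_nonneg]
  exact integral_mono (hM _) (hM _) fun x => birkhoffMax_monotone x n.le_succ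

lemma ae_bddAbove_range_birkhoffSum (hT : Ergodic T μ) (hf : Measurable f) (hfi : Integrable f μ)
    (hneg : ∫ x, f x ∂μ < 0) :
    ∀ᵐ x ∂μ, BddAbove (Set.range fun n => birkhoffSum T f n x) := by
  rcases hT.ae_mem_or_ae_notMem (measurableSet_birkhoffUnbounded hT.measurable hf)
    preimage_birkhoffUnbounded with h | h
  · have := setIntegral_birkhoffUnbounded_nonneg hT.toMeasurePreserving hf hfi
    rw [Measure.restrict_eq_self_of_ae_mem h] at this
    exact absurd this hneg.not_ge
  · filter_upwards [h] with x hx using not_not.1 hx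

variable [IsProbabilityMeasure μ]

lemma ae_eventually_birkhoffAverage_lt (hT : Ergodic T μ) (hf : Measurable f)
    (hfi : Integrable f μ) {c : ℝ} (hc : ∫ x, f x ∂μ < c) :
    ∀ᵐ x ∂μ, ∀ᶠ n in atTop, birkhoffAverage ℝ T f n x < c := by
  obtain ⟨b, hb, hbc⟩ := exists_between hc
  have hneg : ∫ x, (f x - b) ∂μ < 0 := by
    rw [integral_sub hfi (integrable_const b)]
    simpa using hb
  filter_upwards [ae_bddAbove_range_birkhoffSum hT (hf.sub_const b)
    (hfi.sub (integrable_const b)) hneg] with x ⟨K, hK⟩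
  have hlim : Tendsto (fun n : ℕ => b + K / n) atTop (𝓝 b) := by
    simpa using (tendsto_const_div_atTop_nhds_zero_nat K).const_add b
  filter_upwards [hlim.eventually_lt_const hbc, eventually_gt_atTop 0] with n hn hn0
  refine lt_of_le_of_lt ?_ hn
  have hn0 : (0 : ℝ) < n := Nat.cast_pos.2 hn0
  have hsum : birkhoffSum T f n x - n * b ≤ K := by
    simpa [birkhoffSum, Finset.sum_sub_distrib] using hK ⟨n, rfl⟩
  rw [birkhoffAverage, smul_eq_mul, inv_mul_le_iff₀ hn0, mul_add, mul_div_cancel₀ _ hn0.ne']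
  linarith

theorem ae_tendsto_birkhoffAverage (hT : Ergodic T μ) (hf : Integrable f μ) :
    ∀ᵐ x ∂μ, Tendsto (fun n => birkhoffAverage ℝ T f n x) atTop (𝓝 (∫ x, f x ∂μ)) := by
  wlog hfm : Measurable f generalizing f
  · obtain ⟨g, hg, hfg⟩ := hf.aestronglyMeasurable.aemeasurable
    have hav := ae_all_iff.2
      (hT.quasiMeasurePreserving.birkhoffAverage_ae_eq_of_ae_eq ℝ hfg)
    filter_upwards [this (hf.congr hfg) hg, hav] with x hx hfgx
    simpa only [hfgx, integral_congr_ae hfg] using hx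
  have hup (c : ℚ) : ∀ᵐ x ∂μ, ∫ x, f x ∂μ < c → ∀ᶠ n in atTop, birkhoffAverage ℝ T f n x < c := by
    by_cases hc : ∫ x, f x ∂μ < c
    · simpa only [hc, true_imp_iff] using ae_eventually_birkhoffAverage_lt hT hfm hf hc
    · simp [hc]
  have hlow (c : ℚ) : ∀ᵐ x ∂μ, c < ∫ x, f x ∂μ → ∀ᶠ n in atTop, c < birkhoffAverage ℝ T f n x := by
    by_cases hc : c < ∫ x, f x ∂μ
    · have hneg : ∫ x, (-f) x ∂μ < -c := by simpa [integral_neg] using hc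
      simpa [hc, birkhoffAverage_neg] using
        ae_eventually_birkhoffAverage_lt hT hfm.neg hf.neg hneg
    · simp [hc]
  filter_upwards [ae_all_iff.2 hup, ae_all_iff.2 hlow] with x hxup hxlow
  refine tendsto_order.2 ⟨fun a ha => ?_, fun a ha => ?_⟩
  · obtain ⟨c, hac, hc⟩ := exists_rat_btwn ha
    filter_upwards [hxlow c hc] with n hn using hac.trans hn
  · obtain ⟨c, hc, hca⟩ := exists_rat_btwn ha
    filter_upwards [hxup c hc] with n hn using hn.trans hca

end Birkhoff

section Bracketing

variable {α β J : Type*} [MeasurableSpace α] [MeasurableSpace β] {μ : Measure α}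
  {f g : J → α → ℝ}

/-- An `ε`-bracket in `L¹(μ)`, encoded as the pair of its lower and upper functions. The inequality
`q.1 ≤ q.2` is not required: it holds almost everywhere as soon as some function lies between. -/
structure IsBracket (μ : Measure α) (ε : ℝ) (q : (α → ℝ) × (α → ℝ)) : Prop where
  integrable_fst : Integrable q.1 μ
  integrable_snd : Integrable q.2 μ
  integral_sub_le : ∫ x, q.2 x ∂μ - ∫ x, q.1 x ∂μ ≤ ε

/-- A family has finite bracketing numbers in `L¹(μ)` if for every `ε > 0` each of its members lies,
almost everywhere, in one of finitely many `ε`-brackets. -/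
def HasFiniteBracketing (μ : Measure α) (f : J → α → ℝ) : Prop :=
  ∀ ε > 0, ∃ Q : Set ((α → ℝ) × (α → ℝ)), Q.Finite ∧ (∀ q ∈ Q, IsBracket μ ε q) ∧
    ∀ j, ∃ q ∈ Q, q.1 ≤ᵐ[μ] f j ∧ f j ≤ᵐ[μ] q.2

/-- Compactness of the space of ultrafilters on `J` makes one bracket per ultrafilter enough. -/
lemma HasFiniteBracketing.of_ultrafilter
    (h : ∀ ε > 0, ∀ 𝒰 : Ultrafilter J, ∃ q, IsBracket μ ε q ∧
      ∀ᶠ j in 𝒰, q.1 ≤ᵐ[μ] f j ∧ f j ≤ᵐ[μ] q.2) :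
    HasFiniteBracketing μ f := by
  intro ε hε
  choose q hq hfq using h ε hε
  obtain ⟨t, ht⟩ := isCompact_univ.elim_finite_subcover
    (fun 𝒰 => {𝒱 : Ultrafilter J | ∀ᶠ j in 𝒱, (q 𝒰).1 ≤ᵐ[μ] f j ∧ f j ≤ᵐ[μ] (q 𝒰).2})
    (fun 𝒰 => ultrafilter_isOpen_basic _) (fun 𝒰 _ => Set.mem_iUnion.2 ⟨𝒰, hfq 𝒰⟩)
  refine ⟨q '' t, t.finite_toSet.image q, Set.forall_mem_image.2 fun 𝒰 _ => hq 𝒰, fun j => ?_⟩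
  obtain ⟨𝒰, h𝒰, hj⟩ := Set.mem_iUnion₂.1 (ht (Set.mem_univ (pure j)))
  exact ⟨q 𝒰, Set.mem_image_of_mem q h𝒰, hj⟩

lemma HasFiniteBracketing.const {φ : α → ℝ} (hφ : Integrable φ μ) :
    HasFiniteBracketing μ fun _ : J => φ :=
  fun ε hε => ⟨{(φ, φ)}, Set.finite_singleton _, by
    rintro _ rfl
    exact ⟨hφ, hφ, by simpa using hε.le⟩, fun _ => ⟨_, rfl, .rfl, .rfl⟩⟩

lemma HasFiniteBracketing.add (hf : HasFiniteBracketing μ f) (hg : HasFiniteBracketing μ g) :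
    HasFiniteBracketing μ fun j x => f j x + g j x := by
  intro ε hε
  obtain ⟨Q, hQ, hQb, hfQ⟩ := hf (ε / 2) (half_pos hε)
  obtain ⟨R, hR, hRb, hgR⟩ := hg (ε / 2) (half_pos hε)
  refine ⟨Set.image2 (· + ·) Q R, hQ.image2 _ hR, Set.forall_mem_image2.2 fun q hq r hr => ?_,
    fun j => ?_⟩
  · obtain ⟨hq1, hq2, hqε⟩ := hQb q hq
    obtain ⟨hr1, hr2, hrε⟩ := hRb r hr
    refine ⟨hq1.add hr1, hq2.add hr2, ?_⟩
    simp only [Prod.fst_add, Prod.snd_add, Pi.add_apply]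
    rw [integral_add hq1 hr1, integral_add hq2 hr2]
    linarith
  · obtain ⟨q, hq, hql, hqu⟩ := hfQ j
    obtain ⟨r, hr, hrl, hru⟩ := hgR j
    refine ⟨q + r, Set.mem_image2_of_mem hq hr, ?_, ?_⟩
    · filter_upwards [hql, hrl] with x h1 h2 using add_le_add h1 h2
    · filter_upwards [hqu, hru] with x h1 h2 using add_le_add h1 h2

lemma HasFiniteBracketing.neg (hf : HasFiniteBracketing μ f) :
    HasFiniteBracketing μ fun j x => -f j x := by
  intro ε hε
  obtain ⟨Q, hQ, hQb, hfQ⟩ := hf ε hε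
  refine ⟨(fun q => (-q.2, -q.1)) '' Q, hQ.image _, Set.forall_mem_image.2 fun q hq => ?_,
    fun j => ?_⟩
  · obtain ⟨hq1, hq2, hqε⟩ := hQb q hq
    refine ⟨hq2.neg, hq1.neg, ?_⟩
    simp only [Pi.neg_apply, integral_neg]
    linarith
  · obtain ⟨q, hq, hql, hqu⟩ := hfQ j
    refine ⟨_, Set.mem_image_of_mem _ hq, ?_, ?_⟩
    · filter_upwards [hqu] with x hx using neg_le_neg hx
    · filter_upwards [hql] with x hx using neg_le_neg hx

lemma HasFiniteBracketing.const_mul {c : ℝ} (hc : 0 < c) (hf : HasFiniteBracketing μ f) :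
    HasFiniteBracketing μ fun j x => c * f j x := by
  intro ε hε
  obtain ⟨Q, hQ, hQb, hfQ⟩ := hf (ε / c) (by positivity)
  refine ⟨(c • ·) '' Q, hQ.image _, Set.forall_mem_image.2 fun q hq => ?_, fun j => ?_⟩
  · obtain ⟨hq1, hq2, hqε⟩ := hQb q hq
    refine ⟨hq1.const_mul c, hq2.const_mul c, ?_⟩
    simp only [Prod.smul_fst, Prod.smul_snd, Pi.smul_apply, smul_eq_mul, integral_const_mul]
    rwa [← mul_sub, ← le_div_iff₀' hc]
  · obtain ⟨q, hq, hql, hqu⟩ := hfQ j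
    refine ⟨_, Set.mem_image_of_mem _ hq, ?_, ?_⟩
    · filter_upwards [hql] with x hx using mul_le_mul_of_nonneg_left hx hc.le
    · filter_upwards [hqu] with x hx using mul_le_mul_of_nonneg_left hx hc.le

lemma HasFiniteBracketing.finset_sum {ι : Type*} {s : Finset ι} {φ : ι → J → α → ℝ}
    (hφ : ∀ i ∈ s, HasFiniteBracketing μ (φ i)) :
    HasFiniteBracketing μ fun j x => ∑ i ∈ s, φ i j x := by
  classical
  induction s using Finset.induction_on with
  | empty =>
    simp only [Finset.sum_empty]
    exact .const (integrable_zero _ _ _)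
  | insert i s hi ih =>
    rw [Finset.forall_mem_insert] at hφ
    simpa only [Finset.sum_insert hi] using hφ.1.add (ih hφ.2)

lemma HasFiniteBracketing.comp_measurePreserving {ν : Measure β} {π : β → α}
    (hf : HasFiniteBracketing μ f) (hπ : MeasurePreserving π ν μ) :
    HasFiniteBracketing ν fun j y => f j (π y) := by
  intro ε hε
  obtain ⟨Q, hQ, hQb, hfQ⟩ := hf ε hε
  refine ⟨(fun q => (q.1 ∘ π, q.2 ∘ π)) '' Q, hQ.image _, Set.forall_mem_image.2 fun q hq => ?_,
    fun j => ?_⟩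
  · obtain ⟨hq1, hq2, hqε⟩ := hQb q hq
    refine ⟨hπ.integrable_comp_of_integrable hq1, hπ.integrable_comp_of_integrable hq2, ?_⟩
    simp only [Function.comp_apply]
    rwa [integral_comp_of_measurePreserving hπ hq1.aestronglyMeasurable,
      integral_comp_of_measurePreserving hπ hq2.aestronglyMeasurable]
  · obtain ⟨q, hq, hql, hqu⟩ := hfQ j
    exact ⟨_, Set.mem_image_of_mem _ hq, hπ.quasiMeasurePreserving.ae hql,
      hπ.quasiMeasurePreserving.ae hqu⟩

/-- Each bracket of `g n` is widened by the error `e n` on both sides. -/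
lemma HasFiniteBracketing.of_ae_abs_sub_le {g : ℕ → J → α → ℝ} {e : ℕ → α → ℝ}
    (hg : ∀ᶠ n in atTop, HasFiniteBracketing μ (g n)) (he : ∀ n, Integrable (e n) μ)
    (he0 : Tendsto (fun n => ∫ x, e n x ∂μ) atTop (𝓝 0))
    (hfg : ∀ᶠ n in atTop, ∀ j, ∀ᵐ x ∂μ, |f j x - g n j x| ≤ e n x) : HasFiniteBracketing μ f := by
  intro ε hε
  obtain ⟨n, hgn, hfgn, hen⟩ := (hg.and <| hfg.and <|
    he0.eventually_lt_const (show 0 < ε / 4 by positivity)).exists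
  obtain ⟨Q, hQ, hQb, hgQ⟩ := hgn (ε / 2) (half_pos hε)
  refine ⟨(fun q => (q.1 - e n, q.2 + e n)) '' Q, hQ.image _,
    Set.forall_mem_image.2 fun q hq => ?_, fun j => ?_⟩
  · obtain ⟨hq1, hq2, hqε⟩ := hQb q hq
    refine ⟨hq1.sub (he n), hq2.add (he n), ?_⟩
    simp only [Pi.sub_apply, Pi.add_apply]
    rw [integral_sub hq1 (he n), integral_add hq2 (he n)]
    linarith
  · obtain ⟨q, hq, hql, hqu⟩ := hgQ j
    refine ⟨_, Set.mem_image_of_mem _ hq, ?_, ?_⟩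
    · filter_upwards [hql, hfgn j] with x hx hxe
      exact sub_le_iff_le_add.2 (by linarith [neg_le_of_abs_le hxe])
    · filter_upwards [hqu, hfgn j] with x hx hxe
      exact (sub_le_iff_le_add'.1 (le_of_abs_le hxe)).trans (add_le_add_left hx _)

end Bracketing

section UniformErgodic

variable {α J : Type*} {T : α → α}

lemma birkhoffAverage_mono {f g : α → ℝ} {x : α} (h : ∀ k, f (T^[k] x) ≤ g (T^[k] x)) (n : ℕ) :
    birkhoffAverage ℝ T f n x ≤ birkhoffAverage ℝ T g n x :=
  smul_le_smul_of_nonneg_left (Finset.sum_le_sum fun k _ => h k) (by positivity)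

variable [MeasurableSpace α] {μ : Measure α} [Countable J] {f : J → α → ℝ}

lemma ae_forall_iterate (hT : Measure.QuasiMeasurePreserving T μ μ) {p : α → Prop}
    (hp : ∀ᵐ x ∂μ, p x) : ∀ᵐ x ∂μ, ∀ k, p (T^[k] x) :=
  ae_all_iff.2 fun k => (hT.iterate k).ae hp

variable [IsProbabilityMeasure μ]

lemma ae_eventually_forall_abs_birkhoffAverage_sub_lt (hT : Ergodic T μ)
    (hfi : ∀ j, Integrable (f j) μ) (hf : HasFiniteBracketing μ f) {ε : ℝ} (hε : 0 < ε) :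
    ∀ᵐ x ∂μ, ∀ᶠ n in atTop, ∀ j, |∫ y, f j y ∂μ - birkhoffAverage ℝ T (f j) n x| < ε := by
  obtain ⟨Q, hQ, hQb, hfQ⟩ := hf (ε / 2) (half_pos hε)
  have hlim : ∀ᵐ x ∂μ, ∀ q ∈ Q,
      Tendsto (fun n => birkhoffAverage ℝ T q.1 n x) atTop (𝓝 (∫ y, q.1 y ∂μ)) ∧
      Tendsto (fun n => birkhoffAverage ℝ T q.2 n x) atTop (𝓝 (∫ y, q.2 y ∂μ)) :=
    (ae_ball_iff hQ.countable).2 fun q hq =>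
      (ae_tendsto_birkhoffAverage hT (hQb q hq).integrable_fst).and
        (ae_tendsto_birkhoffAverage hT (hQb q hq).integrable_snd)
  have horbit : ∀ᵐ x ∂μ, ∀ j, ∃ q ∈ Q, (q.1 ≤ᵐ[μ] f j ∧ f j ≤ᵐ[μ] q.2) ∧
      (∀ k, q.1 (T^[k] x) ≤ f j (T^[k] x)) ∧ ∀ k, f j (T^[k] x) ≤ q.2 (T^[k] x) := by
    refine ae_all_iff.2 fun j => ?_
    obtain ⟨q, hq, hql, hqu⟩ := hfQ j
    filter_upwards [ae_forall_iterate hT.quasiMeasurePreserving hql,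
      ae_forall_iterate hT.quasiMeasurePreserving hqu] with x hxl hxu
    exact ⟨q, hq, ⟨hql, hqu⟩, hxl, hxu⟩
  filter_upwards [hlim, horbit] with x hxlim hx
  have hclose : ∀ᶠ n in atTop, ∀ q ∈ Q, ∫ y, q.1 y ∂μ - ε / 2 < birkhoffAverage ℝ T q.1 n x ∧
      birkhoffAverage ℝ T q.2 n x < ∫ y, q.2 y ∂μ + ε / 2 :=
    hQ.eventually_all.2 fun q hq =>
      ((hxlim q hq).1.eventually_const_lt (sub_lt_self _ (half_pos hε))).and
        ((hxlim q hq).2.eventually_lt_const (lt_add_of_pos_right _ (half_pos hε)))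
  filter_upwards [hclose] with n hn j
  obtain ⟨q, hq, ⟨hql, hqu⟩, hxl, hxu⟩ := hx j
  obtain ⟨hq1, hq2, hqε⟩ := hQb q hq
  have hlow := birkhoffAverage_mono hxl n
  have hup := birkhoffAverage_mono hxu n
  have hilow := integral_mono_ae hq1 (hfi j) hql
  have hiup := integral_mono_ae (hfi j) hq2 hqu
  obtain ⟨hnlow, hnup⟩ := hn q hq
  rw [abs_lt]
  constructor <;> linarith

theorem ae_tendstoUniformly_birkhoffAverage (hT : Ergodic T μ) (hfi : ∀ j, Integrable (f j) μ)
    (hf : HasFiniteBracketing μ f) :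
    ∀ᵐ x ∂μ, TendstoUniformly (fun n j => birkhoffAverage ℝ T (f j) n x)
      (fun j => ∫ y, f j y ∂μ) atTop := by
  have h := ae_all_iff.2 fun k : ℕ => ae_eventually_forall_abs_birkhoffAverage_sub_lt hT hfi hf
    (Nat.one_div_pos_of_nat (α := ℝ) (n := k))
  filter_upwards [h] with x hx
  refine Metric.tendstoUniformly_iff.2 fun ε hε => ?_
  obtain ⟨k, hk⟩ := exists_nat_one_div_lt hε
  filter_upwards [hx k] with n hn j using (hn j).trans hk

end UniformErgodic

section VCDimension

variable {α ι : Type*} {𝒞 : Set (Set α)}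

lemma card_le_vcDim {D : Finset α} (hD : ∀ E ⊆ D, ∃ C ∈ 𝒞, (E : Set α) = C ∩ D) :
    (D.card : ℕ∞) ≤ vcDim 𝒞 := by
  have htraces : {E : Set α | ∃ C ∈ 𝒞, E = C ∩ D} = 𝒫 (D : Set α) := by
    ext E
    refine ⟨?_, fun hE => ?_⟩
    · rintro ⟨C, -, rfl⟩
      exact Set.inter_subset_right
    · lift E to Finset α using D.finite_toSet.subset hE
      exact hD E (Finset.coe_subset.1 hE)
  have hshatter : shatterCoeff D 𝒞 = 2 ^ D.card := by
    rw [shatterCoeff, htraces, Set.ncard_powerset _ D.finite_toSet, Set.ncard_coe_finset]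
  exact le_iSup₂_of_le D hshatter le_rfl

/-- The atom of the Boolean algebra generated by the sets `c i` consisting of the points that lie in
`c i` exactly for the indices `i ∈ s`. -/
def booleanAtom (c : ι → Set α) (s : Set ι) : Set α := {x | ∀ i, x ∈ c i ↔ i ∈ s}

lemma measurableSet_booleanAtom [MeasurableSpace α] [Countable ι] {c : ι → Set α}
    (hc : ∀ i, MeasurableSet (c i)) (s : Set ι) : MeasurableSet (booleanAtom c s) := by
  simp only [booleanAtom, Set.ofPred_forall]
  refine .iInter fun i => ?_
  by_cases hi : i ∈ s <;> simp only [hi, iff_true, iff_false]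
  exacts [hc i, (hc i).compl]

/-- The points that are shattered are one point `x i` from the atom `{t | i ∈ t}` for each `i`. -/
lemma card_le_vcDim_of_booleanAtom_nonempty [Fintype ι] {c : Set ι → Set α} (hc : ∀ t, c t ∈ 𝒞)
    (hne : ∀ s, (booleanAtom c s).Nonempty) : (Fintype.card ι : ℕ∞) ≤ vcDim 𝒞 := by
  choose x hx using fun i : ι => hne {t | i ∈ t}
  have hx (i : ι) (t : Set ι) : x i ∈ c t ↔ i ∈ t := hx i t
  have hinj : Function.Injective x := fun i j hij => by
    have : x i ∈ c {j} := hij ▸ (hx j {j}).2 rfl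
    exact (hx i {j}).1 this
  rw [← Finset.card_univ, ← Finset.card_map ⟨x, hinj⟩]
  refine card_le_vcDim fun E hE => ⟨c (x ⁻¹' E), hc _, ?_⟩
  ext y
  simp only [Finset.coe_map, Function.Embedding.coeFn_mk, Finset.coe_univ, Set.image_univ]
  constructor
  · intro hy
    obtain ⟨i, -, rfl⟩ := Finset.mem_map.1 (hE hy)
    exact ⟨(hx i _).2 hy, i, rfl⟩
  · rintro ⟨hy, i, rfl⟩
    exact (hx i _).1 hy

end VCDimension

section Exhaustion

variable {α J : Type*} [MeasurableSpace α] {μ : Measure α} [IsFiniteMeasure μ]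

lemma exists_monotone_exhaustion {𝒮 : Set (Set α)}
    (hm : ∀ s ∈ 𝒮, MeasurableSet s) (hempty : ∅ ∈ 𝒮)
    (hunion : ∀ s ∈ 𝒮, ∀ t ∈ 𝒮, s ∪ t ∈ 𝒮) :
    ∃ V : ℕ → Set α, Monotone V ∧ (∀ n, V n ∈ 𝒮) ∧ ∀ s ∈ 𝒮, s ≤ᵐ[μ] ⋃ n, V n := by
  obtain ⟨v, -, hv, hv𝒮⟩ := exists_seq_tendsto_sSup (S := μ '' 𝒮) ⟨_, ∅, hempty, rfl⟩
    (OrderTop.bddAbove _)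
  choose w hw hwv using hv𝒮
  have hacc n : Set.accumulate w n ∈ 𝒮 := by
    induction n with
    | zero => simpa using hw 0
    | succ n ih =>
      rw [Set.accumulate_succ]
      exact hunion _ ih _ (hw _)
  refine ⟨Set.accumulate w, Set.monotone_accumulate, hacc, fun s hs => ?_⟩
  set V := ⋃ n, Set.accumulate w n
  have hle : sSup (μ '' 𝒮) ≤ μ V := le_of_tendsto' hv fun n => hwv n ▸
    measure_mono (Set.subset_accumulate.trans (Set.subset_iUnion _ n))
  have hge : μ (V ∪ s) ≤ sSup (μ '' 𝒮) := by
    rw [Set.iUnion_union]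
    exact le_of_tendsto' (tendsto_measure_iUnion_atTop fun i j hij =>
      Set.union_subset_union_left s (Set.monotone_accumulate hij))
      fun n => le_sSup ⟨_, hunion _ (hacc n) _ hs, rfl⟩
  have hVs : V =ᵐ[μ] (V ∪ s : Set α) := ae_eq_of_subset_of_measure_ge Set.subset_union_left
    (hge.trans hle) (MeasurableSet.iUnion fun n => hm _ (hacc n)).nullMeasurableSet
    (measure_ne_top _ _)
  exact (Set.subset_union_right.eventuallyLE).trans hVs.symm.le

lemma exists_monotone_eventually_ae_le (l : Filter J) (C : J → Set α) :
    ∃ V : ℕ → Set α, Monotone V ∧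
      (∀ n, MeasurableSet (V n) ∧ ∀ᶠ j in l, V n ≤ᵐ[μ] C j) ∧
      ∀ s, MeasurableSet s → (∀ᶠ j in l, s ≤ᵐ[μ] C j) → s ≤ᵐ[μ] ⋃ n, V n := by
  obtain ⟨V, hV, hV𝒮, hexh⟩ := exists_monotone_exhaustion (μ := μ)
    (𝒮 := {s | MeasurableSet s ∧ ∀ᶠ j in l, s ≤ᵐ[μ] C j}) (fun s hs => hs.1)
    ⟨.empty, .of_forall fun j => (Set.empty_subset _).eventuallyLE⟩
    (fun s hs t ht => ⟨hs.1.union ht.1, by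
      filter_upwards [hs.2, ht.2] with j hsj htj
      simpa only [Set.union_self] using ae_le_set_union hsj htj⟩)
  exact ⟨V, hV, hV𝒮, fun s hs hsC => hexh s ⟨hs, hsC⟩⟩

end Exhaustion

section SetBracketing

variable {α J : Type*} [MeasurableSpace α] {μ : Measure α} {C : J → Set α}

/-- Along the filter `l`, the sets `C j` eventually split every nonnull measurable subset of `G`
into two nonnull pieces: the obstruction to trapping the `C j` in a small bracket. -/
def EventuallySplits (μ : Measure α) (C : J → Set α) (l : Filter J) (G : Set α) : Prop :=
  ∀ B ⊆ G, MeasurableSet B → μ B ≠ 0 → ∀ᶠ j in l, μ (B ∩ C j) ≠ 0 ∧ μ (B \ C j) ≠ 0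

/-- Choosing the sets one at a time, each splits all the atoms of its predecessors. -/
lemma EventuallySplits.exists_booleanAtom_measure_ne_zero (hC : ∀ j, MeasurableSet (C j))
    {l : Filter J} [l.NeBot] {G : Set α} (hsplit : EventuallySplits μ C l G)
    (hG : MeasurableSet G) (hG0 : μ G ≠ 0) (ι : Type*) [Finite ι] :
    ∃ c : ι → J, ∀ s, μ (G ∩ booleanAtom (C ∘ c) s) ≠ 0 := by
  induction ι using Finite.induction_empty_option with
  | of_equiv e ih =>
    obtain ⟨c, hc⟩ := ih
    refine ⟨c ∘ e.symm, fun s => ?_⟩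
    convert hc (e ⁻¹' s) using 3
    ext x
    simp [booleanAtom, e.forall_congr_left]
  | h_empty => exact ⟨isEmptyElim, fun s => by simpa [booleanAtom] using hG0⟩
  | h_option ih =>
    obtain ⟨c, hc⟩ := ih
    obtain ⟨j, hj⟩ := (eventually_all.2 fun s => hsplit _ Set.inter_subset_left
      (hG.inter (measurableSet_booleanAtom (fun i => hC (c i)) s)) (hc s)).exists
    refine ⟨fun i => i.elim j c, fun s => ?_⟩
    obtain ⟨hin, hout⟩ := hj (some ⁻¹' s)
    by_cases hs : none ∈ s
    · convert hin using 2
      ext x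
      simp [booleanAtom, Option.forall, hs]
      tauto
    · convert hout using 2
      ext x
      simp [booleanAtom, Option.forall, hs]
      tauto

lemma indicator_one_ae_le {s t : Set α} (h : s ≤ᵐ[μ] t) :
    s.indicator (1 : α → ℝ) ≤ᵐ[μ] t.indicator 1 := by
  filter_upwards [h] with x hx
  by_cases hs : x ∈ s
  · have ht : x ∈ t := hx hs
    simp [hs, ht]
  · rw [Set.indicator_of_notMem hs]
    exact Set.indicator_nonneg (fun _ _ => zero_le_one) x

variable [IsFiniteMeasure μ]

/-- With `V` and `W` exhausting the sets that eventually lie in `C j` and in `(C j)ᶜ`, the gaps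
`(W n)ᶜ \ V n` decrease to a set that is null or eventually split. -/
lemma exists_bracket_or_eventuallySplits (𝒰 : Ultrafilter J) (C : J → Set α) {ε : ℝ≥0∞}
    (hε : 0 < ε) :
    (∃ l u, MeasurableSet l ∧ MeasurableSet u ∧ μ (u \ l) < ε ∧
      ∀ᶠ j in 𝒰, l ≤ᵐ[μ] C j ∧ C j ≤ᵐ[μ] u) ∨
    ∃ G, MeasurableSet G ∧ μ G ≠ 0 ∧ EventuallySplits μ C 𝒰 G := by
  obtain ⟨V, hVmono, hV, hVexh⟩ := exists_monotone_eventually_ae_le (μ := μ) (𝒰 : Filter J) C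
  obtain ⟨W, hWmono, hW, hWexh⟩ :=
    exists_monotone_eventually_ae_le (μ := μ) (𝒰 : Filter J) fun j => (C j)ᶜ
  have hmeas n : MeasurableSet ((W n)ᶜ \ V n) := (hW n).1.compl.diff (hV n).1
  by_cases hG : μ (⋂ n, (W n)ᶜ \ V n) = 0
  · left
    have hlim : Tendsto (fun n => μ ((W n)ᶜ \ V n)) atTop (𝓝 0) := hG ▸
      tendsto_measure_iInter_atTop (fun n => (hmeas n).nullMeasurableSet)
        (fun i j hij => Set.sdiff_subset_sdiff (Set.compl_subset_compl.2 (hWmono hij))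
          (hVmono hij)) ⟨0, measure_ne_top _ _⟩
    obtain ⟨n, hn⟩ := (hlim.eventually_lt_const hε).exists
    refine ⟨V n, (W n)ᶜ, (hV n).1, (hW n).1.compl, hn, (hV n).2.and ?_⟩
    filter_upwards [(hW n).2] with j hj
    simpa only [compl_compl] using hj.compl
  · right
    refine ⟨_, .iInter hmeas, hG, fun B hBG hB hB0 => ?_⟩
    have hVG : Disjoint B (⋃ n, V n) := Set.disjoint_iUnion_right.2 fun n =>
      Set.disjoint_left.2 fun x hx => (Set.mem_iInter.1 (hBG hx) n).2
    have hWG : Disjoint B (⋃ n, W n) := Set.disjoint_iUnion_right.2 fun n =>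
      Set.disjoint_left.2 fun x hx => (Set.mem_iInter.1 (hBG hx) n).1
    have hnot {U : Set α} (hU : Disjoint B U) : ¬ B ≤ᵐ[μ] U := fun h =>
      hB0 (hU.sdiff_eq_left ▸ ae_le_set.1 h)
    refine (Ultrafilter.eventually_not.2 fun h => hnot hWG (hWexh B hB ?_)).and
      (Ultrafilter.eventually_not.2 fun h => hnot hVG (hVexh B hB ?_))
    · filter_upwards [h] with j hj
      rwa [ae_le_set, Set.sdiff_compl]
    · filter_upwards [h] with j hj using ae_le_set.2 hj

lemma isBracket_indicator {l u : Set α} (hl : MeasurableSet l) (hu : MeasurableSet u) {ε : ℝ}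
    (hε : 0 ≤ ε) (hlu : μ (u \ l) ≤ ENNReal.ofReal ε) :
    IsBracket μ ε (l.indicator 1, u.indicator 1) := by
  refine ⟨(integrable_const 1).indicator hl, (integrable_const 1).indicator hu, ?_⟩
  rw [integral_indicator_one hl, integral_indicator_one hu]
  exact (le_measureReal_sdiff (measure_ne_top μ l)).trans
    (ENNReal.toReal_le_of_le_ofReal hε hlu)

theorem hasFiniteBracketing_indicator (hC : ∀ j, MeasurableSet (C j))
    (hvc : vcDim (Set.range C) ≠ ⊤) :
    HasFiniteBracketing μ fun j => (C j).indicator 1 := by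
  refine .of_ultrafilter fun ε hε 𝒰 => ?_
  rcases exists_bracket_or_eventuallySplits (μ := μ) 𝒰 C (ENNReal.ofReal_pos.2 hε) with
    ⟨l, u, hl, hu, hlu, hev⟩ | ⟨G, hG, hG0, hsplit⟩
  · refine ⟨_, isBracket_indicator hl hu hε.le hlu.le, ?_⟩
    filter_upwards [hev] with j hj using ⟨indicator_one_ae_le hj.1, indicator_one_ae_le hj.2⟩
  · refine absurd (ENat.eq_top_iff_forall_ge.2 fun k => ?_) hvc
    obtain ⟨c, hc⟩ := hsplit.exists_booleanAtom_measure_ne_zero hC hG hG0 (Set (Fin k))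
    simpa using card_le_vcDim_of_booleanAtom_nonempty (fun t => Set.mem_range_self (c t))
      fun s => (nonempty_of_measure_ne_zero (hc s)).mono Set.inter_subset_right

end SetBracketing

section Staircase

/-- The staircase with steps of height `1 / n` that approximates the identity on `[-n, n]` and is
constant outside; being a combination of indicators of half-lines, it turns a function into a
combination of indicators of its level sets. -/
noncomputable def staircase (n : ℕ) (t : ℝ) : ℝ :=
  n - (n : ℝ)⁻¹ * ∑ k ∈ Finset.range (2 * n ^ 2), (Set.Iic (-n + k / n : ℝ)).indicator 1 t

lemma staircase_eq_ceil {n : ℕ} (hn : n ≠ 0) (t : ℝ) :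
    staircase n t = n - (n : ℝ)⁻¹ * (2 * n ^ 2 - ⌈(t + n) * n⌉₊ : ℕ) := by
  classical
  have hn0 : (0 : ℝ) < n := by positivity
  have hlevels : {k ∈ Finset.range (2 * n ^ 2) | t ∈ Set.Iic (-n + (k : ℕ) / n : ℝ)} =
      Finset.Ico ⌈(t + n) * n⌉₊ (2 * n ^ 2) := by
    ext k
    have hk : t ≤ -n + k / n ↔ (t + n) * n ≤ k := by
      rw [← le_div_iff₀ hn0, add_comm, ← sub_eq_add_neg, le_sub_iff_add_le]
    rw [Finset.mem_filter, Finset.mem_range, Finset.mem_Ico, Nat.ceil_le, and_comm, ← hk,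
      Set.mem_Iic]
  simp only [staircase, Set.indicator_apply, Pi.one_apply]
  rw [Finset.sum_boole, hlevels, Nat.card_Ico]

lemma staircase_of_le {n : ℕ} (hn : n ≠ 0) {t : ℝ} (ht : n ≤ t) : staircase n t = n := by
  have hceil : 2 * n ^ 2 ≤ ⌈(t + n) * n⌉₊ := by
    refine Nat.cast_le (α := ℝ).1 (le_trans ?_ (Nat.le_ceil _))
    push_cast
    nlinarith
  rw [staircase_eq_ceil hn, Nat.sub_eq_zero_of_le hceil, Nat.cast_zero, mul_zero, sub_zero]

lemma staircase_of_le_neg {n : ℕ} (hn : n ≠ 0) {t : ℝ} (ht : t ≤ -n) : staircase n t = -n := by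
  have : (0 : ℝ) < n := by positivity
  have hceil : ⌈(t + n) * n⌉₊ = 0 := Nat.ceil_eq_zero.2 (by nlinarith)
  rw [staircase_eq_ceil hn, hceil, Nat.sub_zero]
  push_cast
  field_simp
  ring

lemma abs_sub_staircase_le_inv {n : ℕ} (hn : n ≠ 0) {t : ℝ} (ht : |t| ≤ n) :
    |t - staircase n t| ≤ (n : ℝ)⁻¹ := by
  have hn0 : (0 : ℝ) < n := by positivity
  obtain ⟨htl, htu⟩ := abs_le.1 ht
  have hpos : 0 ≤ (t + n) * n := mul_nonneg (by linarith) hn0.le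
  have hceil : ⌈(t + n) * n⌉₊ ≤ 2 * n ^ 2 := Nat.ceil_le.2 (by push_cast; nlinarith)
  have hsub : t - staircase n t = (n : ℝ)⁻¹ * ((t + n) * n - ⌈(t + n) * n⌉₊) := by
    rw [staircase_eq_ceil hn]
    push_cast [hceil]
    field_simp
    ring
  rw [hsub, abs_mul, abs_inv, Nat.abs_cast]
  refine mul_le_of_le_one_right (by positivity) (abs_le.2 ⟨?_, ?_⟩)
  · linarith [Nat.ceil_lt_add_one hpos]
  · linarith [Nat.le_ceil ((t + n) * n)]

lemma abs_sub_staircase_le {n : ℕ} (hn : n ≠ 0) (t : ℝ) :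
    |t - staircase n t| ≤ (n : ℝ)⁻¹ + max (|t| - n) 0 := by
  have hn0 : (0 : ℝ) < n := by positivity
  rcases le_or_gt |t| n with ht | ht
  · exact (abs_sub_staircase_le_inv hn ht).trans (le_add_of_nonneg_right (le_max_right _ _))
  · suffices h : |t - staircase n t| = |t| - n from
      h.trans_le (le_add_of_nonneg_of_le (by positivity) (le_max_left _ _))
    rcases lt_abs.1 ht with ht | ht
    · rw [staircase_of_le hn ht.le, abs_of_pos (sub_pos.2 ht), abs_of_pos (hn0.trans ht)]
    · rw [staircase_of_le_neg hn (by linarith), abs_of_neg (by linarith), abs_of_neg (by linarith)]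
      ring

end Staircase

section LevelSets

variable {α J : Type*} [MeasurableSpace α] {μ : Measure α} [IsFiniteMeasure μ] {f : J → α → ℝ}

lemma HasFiniteBracketing.staircase_comp
    (hf : ∀ a, HasFiniteBracketing μ fun j => (levelSet (f j) a).indicator 1)
    {n : ℕ} (hn : n ≠ 0) : HasFiniteBracketing μ fun j x => staircase n (f j x) := by
  simp only [staircase, sub_eq_add_neg]
  have hn0 : (0 : ℝ) < (n : ℝ)⁻¹ := by positivity
  exact (HasFiniteBracketing.const (integrable_const _)).add
    ((HasFiniteBracketing.finset_sum fun _ _ => hf _).const_mul hn0).neg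

lemma tendsto_integral_inv_add_max_sub {F : α → ℝ} (hF : Integrable F μ) :
    Tendsto (fun n : ℕ => ∫ x, ((n : ℝ)⁻¹ + max (F x - n) 0) ∂μ) atTop (𝓝 0) := by
  suffices h : Tendsto (fun n : ℕ => ∫ x, ((n : ℝ)⁻¹ + max (F x - n) 0) ∂μ) atTop
      (𝓝 (∫ _, (0 : ℝ) ∂μ)) by simpa only [integral_zero] using h
  refine tendsto_integral_of_dominated_convergence (fun x => 1 + |F x|) (fun n => ?_)
    ((integrable_const 1).add hF.abs) (fun n => ae_of_all _ fun x => ?_) (ae_of_all _ fun x => ?_)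
  · exact ((integrable_const _).add
      ((hF.sub (integrable_const _)).sup (integrable_zero _ _ _))).aestronglyMeasurable
  · rw [Real.norm_of_nonneg (by positivity)]
    refine add_le_add n.cast_inv_le_one (max_le ?_ (abs_nonneg _))
    exact (sub_le_self _ n.cast_nonneg).trans (le_abs_self _)
  · have htrunc : Tendsto (fun n : ℕ => max (F x - n) 0) atTop (𝓝 0) := by
      refine tendsto_const_nhds.congr' ?_
      filter_upwards [eventually_ge_atTop ⌈F x⌉₊] with n hn
      exact (max_eq_right (sub_nonpos.2 (Nat.ceil_le.1 hn))).symm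
    simpa using tendsto_inv_atTop_nhds_zero_nat.add htrunc

theorem HasFiniteBracketing.of_levelSet
    (hf : ∀ a, HasFiniteBracketing μ fun j => (levelSet (f j) a).indicator 1)
    {F : α → ℝ} (hF : Integrable F μ) (hfF : ∀ j, ∀ᵐ x ∂μ, |f j x| ≤ F x) :
    HasFiniteBracketing μ f := by
  refine .of_ae_abs_sub_le (g := fun n j x => staircase n (f j x))
    (e := fun n x => (n : ℝ)⁻¹ + max (F x - n) 0) ?_
    (fun n => (integrable_const _).add ((hF.sub (integrable_const _)).sup (integrable_zero _ _ _)))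
    (tendsto_integral_inv_add_max_sub hF) ?_
  · filter_upwards [eventually_ne_atTop 0] with n hn using .staircase_comp hf hn
  · filter_upwards [eventually_ne_atTop 0] with n hn j
    filter_upwards [hfF j] with x hx
    exact (abs_sub_staircase_le hn (f j x)).trans (by gcongr)

end LevelSets

section StationaryProcess

variable {Ω α : Type*}

lemma iterate_seqShift_apply_zero (x : ℕ → α) (i : ℕ) : seqShift^[i] x 0 = x i := by
  induction i generalizing x with
  | zero => rfl
  | succ i ih => rw [Function.iterate_succ_apply, ih, seqShift]

variable [MeasurableSpace Ω] {X : ℕ → Ω → α} {P : Measure Ω}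

lemma tendsto_uniformDeviation_of_tendstoUniformly {𝓕 : Set (α → ℝ)} {ω : Ω}
    (h : TendstoUniformly
      (fun (m : ℕ) (f : 𝓕) => (m : ℝ)⁻¹ * ∑ i ∈ Finset.range m, f.1 (X i ω))
      (fun f => ∫ ω', f.1 (X 0 ω') ∂P) atTop) :
    Tendsto (fun m => uniformDeviation 𝓕 X P m ω) atTop (𝓝 0) := by
  refine ENNReal.tendsto_nhds_zero.2 fun ε hε => ?_
  filter_upwards [EMetric.tendstoUniformly_iff.1 h ε hε] with m hm
  refine iSup₂_le fun f hf => ?_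
  rw [← Real.dist_eq, ← edist_dist, edist_comm]
  exact (hm ⟨f, hf⟩).le

variable [MeasurableSpace α]

lemma IsStationaryErgodic.measurable_path (hX : IsStationaryErgodic X P) :
    Measurable fun ω n => X n ω :=
  measurable_pi_lambda _ hX.measurable

lemma IsStationaryErgodic.ergodic_seqShift (hX : IsStationaryErgodic X P) :
    Ergodic seqShift (processLaw X P) :=
  ⟨hX.stationary, hX.ergodic⟩

lemma measurePreserving_eval_zero_processLaw (hX : ∀ n, Measurable (X n)) :
    MeasurePreserving (fun x : ℕ → α => x 0) (processLaw X P) (P.map (X 0)) :=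
  ⟨measurable_pi_apply 0, Measure.map_map (measurable_pi_apply 0) (measurable_pi_lambda _ hX)⟩

theorem IsStationaryErgodic.ae_tendstoUniformly {J : Type*} [Countable J] [IsProbabilityMeasure P]
    (hX : IsStationaryErgodic X P) {f : J → α → ℝ} (hfi : ∀ j, Integrable (f j) (P.map (X 0)))
    (hf : HasFiniteBracketing (P.map (X 0)) f) :
    ∀ᵐ ω ∂P, TendstoUniformly (fun (m : ℕ) j => (m : ℝ)⁻¹ * ∑ i ∈ Finset.range m, f j (X i ω))
      (fun j => ∫ ω, f j (X 0 ω) ∂P) atTop := by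
  have hpath : AEMeasurable (fun ω n => X n ω) P := hX.measurable_path.aemeasurable
  have : IsProbabilityMeasure (processLaw X P) := Measure.isProbabilityMeasure_map hpath
  have heval := measurePreserving_eval_zero_processLaw (P := P) hX.measurable
  have hmean j : ∫ x, f j (x 0) ∂(processLaw X P) = ∫ ω, f j (X 0 ω) ∂P := by
    rw [integral_comp_of_measurePreserving heval (hfi j).aestronglyMeasurable,
      integral_map (hX.measurable 0).aemeasurable (hfi j).aestronglyMeasurable]
  have hlaw := ae_tendstoUniformly_birkhoffAverage hX.ergodic_seqShift
    (fun j => heval.integrable_comp_of_integrable (hfi j)) (hf.comp_measurePreserving heval)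
  filter_upwards [ae_of_ae_map hpath hlaw] with ω hω
  simpa only [birkhoffAverage, birkhoffSum, smul_eq_mul, Function.comp_apply,
    iterate_seqShift_apply_zero, hmean] using hω

end StationaryProcess

theorem proposition1_general {Ω α : Type*} [MeasurableSpace Ω] [MeasurableSpace α]
    {𝓕 : Set (α → ℝ)} (h𝓕_countable : 𝓕.Countable) (h𝓕_meas : ∀ f ∈ 𝓕, Measurable f)
    {F : α → ℝ} (hF : IsEnvelope F 𝓕)
    (h𝓕_vc : ∀ a, vcDim {L : Set α | ∃ f ∈ 𝓕, L = levelSet f a} ≠ ⊤)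
    {P : Measure Ω} [IsProbabilityMeasure P] {X : ℕ → Ω → α} (hX : IsStationaryErgodic X P)
    (hFX : Integrable (fun ω => F (X 0 ω)) P) :
    IsGlivenkoCantelli 𝓕 X P := by
  have hX0 : AEMeasurable (X 0) P := (hX.measurable 0).aemeasurable
  have : Countable 𝓕 := h𝓕_countable.to_subtype
  have : IsProbabilityMeasure (P.map (X 0)) := Measure.isProbabilityMeasure_map hX0
  have hFi : Integrable F (P.map (X 0)) :=
    (integrable_map_measure hF.measurable.aestronglyMeasurable hX0).2 hFX
  have hfi (f : 𝓕) : Integrable f.1 (P.map (X 0)) :=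
    hFi.mono' (h𝓕_meas f f.2).aestronglyMeasurable (ae_of_all _ (hF.abs_le f f.2))
  have hlevel (a : ℝ) :
      HasFiniteBracketing (P.map (X 0)) fun f : 𝓕 => (levelSet f.1 a).indicator 1 := by
    refine hasFiniteBracketing_indicator
      (fun f => measurableSet_le (h𝓕_meas f f.2) measurable_const) ?_
    simpa only [Set.range, Subtype.exists, exists_prop, eq_comm] using h𝓕_vc a
  have hbracket : HasFiniteBracketing (P.map (X 0)) fun f : 𝓕 => f.1 :=
    .of_levelSet hlevel hFi fun f => ae_of_all _ (hF.abs_le f f.2)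
  refine ⟨fun f hf => (hfi ⟨f, hf⟩).comp_measurable (hX.measurable 0), ?_⟩
  filter_upwards [hX.ae_tendstoUniformly hfi hbracket] with ω hω
  exact tendsto_uniformDeviation_of_tendstoUniformly hω

theorem proposition1 {𝒳 : Type*} [MetricSpace 𝒳] [CompleteSpace 𝒳]
    [TopologicalSpace.SeparableSpace 𝒳] [MeasurableSpace 𝒳] [BorelSpace 𝒳]
    (𝓕 : Set (𝒳 → ℝ)) (h𝓕_countable : 𝓕.Countable) (h𝓕_meas : ∀ f ∈ 𝓕, Measurable f)
    (F : 𝒳 → ℝ) (hF : IsEnvelope F 𝓕) (h𝓕_major : IsVCMajor 𝓕)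
    {Ω : Type*} [MeasurableSpace Ω] (P : Measure Ω) [IsProbabilityMeasure P]
    (X : ℕ → Ω → 𝒳) (hX : IsStationaryErgodic X P)
    (hFX : Integrable (fun ω => F (X 0 ω)) P) :
    IsGlivenkoCantelli 𝓕 X P :=
  proposition1_general h𝓕_countable h𝓕_meas hF
    (fun a => ((le_iSup (fun a => vcDim {L | ∃ f ∈ 𝓕, L = levelSet f a}) a).trans_lt
      h𝓕_major).ne) hX hFX
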